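/- Let $n\ge 0$. There are $n$ traders $1,\dots,n$; trader $k$ initially owns good $k$ and has a preference list $p_k=p_{k1}p_{k2}\cdots p_{kn}$, a permutation of $\{1,\dots,n\}$ that lists the goods from most to least preferred. An allocation is a permutation $g_1\dots g_n$ of $\{1,\dots,n\}$ (trader $k$ gets good $g_k$); its ranks $r_1,\dots,r_n$ are defined by $g_k=p_{kr_k}$. The allocation $g$ is *stable* (a core allocation) if for every nonempty set $C$ of traders and every bijection $h:C\to C$ (a redistribution of the goods of $C$ among $C$) such that every $k\in C$ either has $h_k=g_k$ or prefers $h_k$ to $g_k$, we have $h_k=g_k$ for all $k\in C$. For a permutation $\pi$ of $\{1,\dots,n\}$, *uniform hashing* (first-come first-served) with priorities $\pi$ produces the ranks $r_1,\dots,r_n$ for which, for $k=1,\dots,n$, the number $r_{\pi(k)}$ is the least $j$ with $p_{\pi(k)j}\notin\{p_{\pi(1)r_{\pi(1)}},\dots,p_{\pi(k-1)r_{\pi(k-1)}}\}$. **Theorem.** For all preference lists $p_1,\dots,p_n$ there is exactly one stable allocation, and for each $\pi$ uniform hashing with priorities $\pi$ produces exactly one sequence of ranks. Suppose now that the preference lists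 $p_1,\dots,p_n$ are independent and uniformly random. Then for every fixed $\pi$ (in particular for the identity) and every multiset $R$, the probability that the unordered multiset $\{r_1,\dots,r_n\}$ of ranks in the stable allocation equals $R$ is the same as the probability that the multiset of ranks produced by uniform hashing with priorities $\pi$ equals $R$. The same conclusion holds, more generally, whenever the random preference lists $p_1,\dots,p_n$ are such that for every permutation $\sigma$ of $\{1,\dots,n\}$ the sequence $(p_{\sigma(1)},\dots,p_{\sigma(n)})$ has the same joint distribution as $(p_1,\dots,p_n)$. -/

import Mathlib

/-- A preference list of one trader over the goods `0, …, n-1`: the value at `j` is the good in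
position `j` (positions are counted from `0`), so that position `0` holds the favourite good. -/
abbrev PrefList (n : ℕ) : Type := Equiv.Perm (Fin n)

/-- The finite set of preference lists carries the discrete sigma-algebra. -/
instance instMeasurableSpacePrefList (n : ℕ) : MeasurableSpace (PrefList n) := ⊤

/-- The preference lists of all `n` traders. Good `k` is the one that trader `k` owns initially. -/
abbrev PrefProfile (n : ℕ) : Type := Fin n → PrefList n

/-- `WeaklyPrefers l x y`: the owner of the list `l` likes good `x` at least as much as good `y`,
that is, `x = y` or `x` precedes `y` in the list. -/
def WeaklyPrefers {n : ℕ} (l : PrefList n) (x y : Fin n) : Prop :=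
  l.symm x ≤ l.symm y

/-- The allocation `g` (trader `k` gets good `g k`) is stable, i.e. a core allocation: whenever a
nonempty coalition `C` redistributes the goods of its own members among its members by `h` in such
a way that no member is worse off than under `g`, then `h` agrees with `g` on `C`. -/
def IsStable {n : ℕ} (p : PrefProfile n) (g : Equiv.Perm (Fin n)) : Prop :=
  ∀ C : Finset (Fin n), C.Nonempty → ∀ h : Fin n → Fin n,
    Set.BijOn h (C : Set (Fin n)) (C : Set (Fin n)) →
    (∀ k ∈ C, WeaklyPrefers (p k) (h k) (g k)) → ∀ k ∈ C, h k = g k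

/-- First-come first-served allocation (uniform hashing) on `p` with priorities `π` puts each
trader `k` at position `r k` of his list: in the order `π 0, π 1, …`, each trader takes the first
item of his list that has not been taken by a trader of higher priority. -/
def HashProduces {n : ℕ} (p : PrefProfile n) (π : Equiv.Perm (Fin n)) (r : Fin n → Fin n) : Prop :=
  ∀ k : Fin n, IsLeast {j : Fin n | ∀ i < k, p (π k) j ≠ p (π i) (r (π i))} (r (π k))

/-- The unordered multiset of the `n` ranks (counted from `1`) that belong to the positions `r k`
(counted from `0`). -/
def rankMultiset {n : ℕ} (r : Fin n → Fin n) : Multiset ℕ :=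
  (Finset.univ : Finset (Fin n)).val.map fun k => (r k : ℕ) + 1

/-- `R` is the multiset of ranks in the stable allocation for `p`. -/
def StableHasRanks {n : ℕ} (p : PrefProfile n) (R : Multiset ℕ) : Prop :=
  ∃ g : Equiv.Perm (Fin n), IsStable p g ∧ rankMultiset (fun k => (p k).symm (g k)) = R

/-- `R` is the multiset of ranks produced by uniform hashing on `p` with priorities `π`. -/
def HashHasRanks {n : ℕ} (p : PrefProfile n) (π : Equiv.Perm (Fin n)) (R : Multiset ℕ) : Prop :=
  ∃ r : Fin n → Fin n, HashProduces p π r ∧ rankMultiset r = R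

/-! Rearrange a fixed profile `p` by all permutations `σ` and count; exchangeability then turns
equal counts into equal probabilities. Index by lists rather than traders, and fix an assignment `a`
of goods to lists; it determines the rank multiset. Let `i` envy `j` if list `i` ranks `a j` above
`a i`. Hashing with priorities `σ` yields `a` iff every envied `j` is served before `i`, so that `σ`
is a linear extension of envy (`hashProduces_iff_envies`). The allocation `a * σ` is stable for the
profile rearranged by `σ` iff envy is acyclic on the cycles of `σ * a`
(`hasTradingHeights_iff_isCycleAcyclic`, `isStable_iff_hasTradingHeights`). For any irreflexive
relation the two kinds of permutation are equinumerous, because both families satisfy the same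
recursion: remove a terminal element (`nonempty_isLinearExtension_equiv_isCycleAcyclic`). Summing
over `a` gives `card_stableHasRanks_comp`. -/

open Equiv

/-! ### Permutations with acyclic cycle quotient, and linear extensions -/

/-- The elements of `S` that are related by `D` to no element of `S`. -/
def IsTerminalIn {α : Type*} (D : α → α → Prop) (S : Finset α) (x : α) : Prop :=
  x ∈ S ∧ ∀ k ∈ S, ¬ D x k

/-- `τ` permutes `S`, and `D` induces an acyclic relation on the cycles of `τ` in `S`; acyclicity
is witnessed by a height function that is constant on cycles. -/
def IsCycleAcyclic {α : Type*} (D : α → α → Prop) (S : Finset α) (τ : Perm α) : Prop :=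
  (∀ i, i ∉ S → τ i = i) ∧
    ∃ ρ : α → ℕ, (∀ i, ρ (τ i) = ρ i) ∧ ∀ i ∈ S, ∀ j ∈ S, D i j → ρ j < ρ i

/-- The union of the cycles of `τ` that consist of terminal elements of `S`. -/
def terminalCycles {α : Type*} (D : α → α → Prop) (S : Finset α) (τ : Perm α) : Set α :=
  {i | ∃ V : Set α, i ∈ V ∧ (∀ v, τ v ∈ V ↔ v ∈ V) ∧ ∀ v ∈ V, IsTerminalIn D S v}

section terminalCycles

variable {α : Type*} {D : α → α → Prop} {S : Finset α} {τ : Perm α}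

theorem isTerminalIn_of_mem_terminalCycles {i : α} (h : i ∈ terminalCycles D S τ) :
    IsTerminalIn D S i := by
  obtain ⟨V, hi, -, hV⟩ := h
  exact hV i hi

theorem apply_mem_terminalCycles_iff (i : α) :
    τ i ∈ terminalCycles D S τ ↔ i ∈ terminalCycles D S τ := by
  constructor
  · rintro ⟨V, hi, hτ, hV⟩
    exact ⟨V, (hτ i).1 hi, hτ, hV⟩
  · rintro ⟨V, hi, hτ, hV⟩
    exact ⟨V, (hτ i).2 hi, hτ, hV⟩

theorem IsCycleAcyclic.apply_mem_iff (h : IsCycleAcyclic D S τ) (i : α) : τ i ∈ S ↔ i ∈ S := by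
  by_cases hi : i ∈ S
  · refine iff_of_true ?_ hi
    by_contra h'
    exact h' (by rwa [τ.injective (h.1 _ h')])
  · rw [h.1 i hi]

/-- The lowest level set of the height is a union of cycles, and no `D`-step can leave one of its
points. -/
theorem IsCycleAcyclic.terminalCycles_nonempty (h : IsCycleAcyclic D S τ) (hS : S.Nonempty) :
    (terminalCycles D S τ).Nonempty := by
  obtain ⟨-, ρ, hρ, hD⟩ := id h
  obtain ⟨m, hm, hmin⟩ := S.exists_min_image ρ hS
  refine ⟨m, {v | v ∈ S ∧ ρ v = ρ m}, ⟨hm, rfl⟩, fun v => ?_, ?_⟩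
  · simp only [Set.mem_ofPred_eq, h.apply_mem_iff, hρ]
  · rintro v ⟨hv, hvm⟩
    refine ⟨hv, fun k hk hvk => ?_⟩
    have h1 := hD v hv k hk hvk
    have h2 := hmin k hk
    omega

theorem IsTerminalIn.mem_terminalCycles {x : α} (hx : IsTerminalIn D S x) (hτx : τ x = x) :
    x ∈ terminalCycles D S τ :=
  ⟨{x}, rfl, fun v => by
    rw [Set.mem_singleton_iff, Set.mem_singleton_iff, ← τ.injective.eq_iff (a := v), hτx],
    by rintro v rfl; exact hx⟩

variable [DecidableEq α]

theorem swap_mem_iff {U : Set α} {m x : α} (hm : m ∈ U) (hx : x ∈ U) (v : α) :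
    swap m x v ∈ U ↔ v ∈ U := by
  rw [swap_apply_def]
  split_ifs with h1 h2 <;> simp_all

theorem terminalCycles_subset_mul_swap {m x : α} (hm : m ∈ terminalCycles D S τ)
    (hx : x ∈ terminalCycles D S τ) :
    terminalCycles D S τ ⊆ terminalCycles D S (τ * swap m x) := fun i hi =>
  ⟨terminalCycles D S τ, hi, fun v => by
    rw [Perm.mul_apply, apply_mem_terminalCycles_iff, swap_mem_iff hm hx],
    fun _ => isTerminalIn_of_mem_terminalCycles⟩

theorem terminalCycles_mul_swap {m x : α} (hm : m ∈ terminalCycles D S τ)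
    (hx : x ∈ terminalCycles D S τ) :
    terminalCycles D S (τ * swap m x) = terminalCycles D S τ := by
  have h := terminalCycles_subset_mul_swap hm hx
  refine (Set.Subset.antisymm h ?_).symm
  have h' := terminalCycles_subset_mul_swap (h hm) (h hx)
  rwa [mul_assoc, swap_mul_self, mul_one] at h'

theorem IsCycleAcyclic.mul_swap (h : IsCycleAcyclic D S τ) {m x : α}
    (hm : m ∈ terminalCycles D S τ) (hx : x ∈ terminalCycles D S τ) :
    IsCycleAcyclic D S (τ * swap m x) := by
  classical
  obtain ⟨hS, ρ, hρ, hD⟩ := h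
  have hmS := (isTerminalIn_of_mem_terminalCycles hm).1
  have hxS := (isTerminalIn_of_mem_terminalCycles hx).1
  -- The swap may merge or split terminal cycles, so the old height need not be constant on the new
  -- ones. Terminal cycles have no outgoing `D`-steps and can all be flattened to height `0` below
  -- the rest.
  refine ⟨fun i hi => ?_, fun i => if i ∈ terminalCycles D S τ then 0 else ρ i + 1,
    fun i => ?_, fun i hi j hj hij => ?_⟩
  · rw [Perm.mul_apply, swap_apply_of_ne_of_ne (by rintro rfl; exact hi hmS)
      (by rintro rfl; exact hi hxS), hS i hi]
  · simp only [Perm.mul_apply, apply_mem_terminalCycles_iff, swap_mem_iff hm hx]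
    split_ifs with hU
    · rfl
    · rw [hρ, swap_apply_of_ne_of_ne (by rintro rfl; exact hU hm) (by rintro rfl; exact hU hx)]
  · have hiU : i ∉ terminalCycles D S τ := fun hU =>
      (isTerminalIn_of_mem_terminalCycles hU).2 j hj hij
    have := hD i hi j hj hij
    simp only [hiU, if_false]
    split_ifs <;> omega

theorem isCycleAcyclic_erase_iff {x : α} (hx : IsTerminalIn D S x) :
    IsCycleAcyclic D (S.erase x) τ ↔ IsCycleAcyclic D S τ ∧ τ x = x := by
  constructor
  · rintro ⟨hS, ρ, hρ, hD⟩
    have hτx : τ x = x := hS x (Finset.notMem_erase x S)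
    refine ⟨⟨fun i hi => hS i fun h => hi (Finset.mem_of_mem_erase h),
      fun i => if i = x then 0 else ρ i + 1, fun i => ?_, fun i hi j hj hij => ?_⟩, hτx⟩
    · have : τ i = x ↔ i = x := by rw [← τ.injective.eq_iff (a := i), hτx]
      simp only [this, hρ]
    · have hix : i ≠ x := by
        rintro rfl
        exact hx.2 j hj hij
      simp only [hix, if_false]
      split_ifs with hjx
      · omega
      · have := hD i (Finset.mem_erase.2 ⟨hix, hi⟩) j (Finset.mem_erase.2 ⟨hjx, hj⟩) hij
        omega
  · rintro ⟨⟨hS, ρ, hρ, hD⟩, hτx⟩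
    refine ⟨fun i hi => ?_, ρ, hρ, fun i hi j hj =>
      hD i (Finset.mem_of_mem_erase hi) j (Finset.mem_of_mem_erase hj)⟩
    by_cases hix : i = x
    · rw [hix, hτx]
    · exact hS i fun h => hi (Finset.mem_erase.2 ⟨hix, h⟩)

/-- Splitting off a terminal element from a terminal cycle. -/
theorem nonempty_isCycleAcyclic_equiv_sigma (hS : S.Nonempty) :
    Nonempty ({τ // IsCycleAcyclic D S τ} ≃
      Σ x : {x // IsTerminalIn D S x}, {τ // IsCycleAcyclic D (S.erase x) τ}) := by
  classical
  -- The chosen point depends only on the union of terminal cycles, which the swap preserves; hence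
  -- it can be recovered from the image. The value at the empty set is arbitrary.
  let ch : Set α → α := fun U => if h : U.Nonempty then h.choose else hS.choose
  have hch : ∀ U : Set α, U.Nonempty → ch U ∈ U := fun U h => by
    simp only [ch, dif_pos h]
    exact h.choose_spec
  let m : Perm α → α := fun τ => ch (terminalCycles D S τ)
  have hm : ∀ τ, IsCycleAcyclic D S τ → m τ ∈ terminalCycles D S τ := fun τ h =>
    hch _ (h.terminalCycles_nonempty hS)
  have hx : ∀ τ, IsCycleAcyclic D S τ → τ (m τ) ∈ terminalCycles D S τ := fun τ h =>
    (apply_mem_terminalCycles_iff _).2 (hm τ h)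
  have hfix : ∀ τ : Perm α, (τ * swap (m τ) (τ (m τ))) (τ (m τ)) = τ (m τ) := fun τ => by
    rw [Perm.mul_apply, swap_apply_right]
  -- With `x = τ (m τ)`, multiplying by `swap (m τ) x` cuts `x` out of its cycle and leaves it
  -- fixed; the same swap puts it back.
  refine ⟨Equiv.ofBijective (fun τ => ⟨⟨τ.1 (m τ.1),
    isTerminalIn_of_mem_terminalCycles (hx τ.1 τ.2)⟩, τ.1 * swap (m τ.1) (τ.1 (m τ.1)),
    (isCycleAcyclic_erase_iff (isTerminalIn_of_mem_terminalCycles (hx τ.1 τ.2))).2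
      ⟨τ.2.mul_swap (hm τ.1 τ.2) (hx τ.1 τ.2), hfix _⟩⟩) ⟨?_, ?_⟩⟩
  · rintro ⟨τ, hτ⟩ ⟨τ', hτ'⟩ h
    have h1 : τ (m τ) = τ' (m τ') := congrArg (fun s => s.1.1) h
    have h2 : τ * swap (m τ) (τ (m τ)) = τ' * swap (m τ') (τ' (m τ')) :=
      congrArg (fun s => s.2.1) h
    have h3 : m τ = m τ' := by
      simp only [m]
      rw [← terminalCycles_mul_swap (hm τ hτ) (hx τ hτ), h2,
        terminalCycles_mul_swap (hm τ' hτ') (hx τ' hτ')]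
    rw [h1, h3] at h2
    exact Subtype.ext (mul_right_cancel h2)
  · rintro ⟨⟨x, hxS⟩, τ', hτ'⟩
    obtain ⟨hA, hτx⟩ := (isCycleAcyclic_erase_iff hxS).1 hτ'
    have hxU := hxS.mem_terminalCycles hτx
    have hm' : m (τ' * swap (m τ') x) = m τ' := by
      simp only [m]
      rw [terminalCycles_mul_swap (hm τ' hA) hxU]
    have hval : (τ' * swap (m τ') x) (m τ') = x := by
      rw [Perm.mul_apply, swap_apply_left, hτx]
    refine ⟨⟨τ' * swap (m τ') x, hA.mul_swap (hm τ' hA) hxU⟩, ?_⟩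
    have e : (τ' * swap (m τ') x) * swap (m τ') x = τ' := by
      rw [mul_assoc, swap_mul_self, mul_one]
    refine Sigma.subtype_ext (Subtype.ext ?_) ?_
    · simp only [hm', hval]
    · simp only [hm', hval, e]

/-- Enumerations of `S` in which no element is related by `D` to a later one. -/
def IsLinearExtension (D : α → α → Prop) (S : Finset α) (l : List α) : Prop :=
  l.Nodup ∧ l.toFinset = S ∧ l.Pairwise fun a b => ¬ D a b

theorem isLinearExtension_cons_iff (hD : ∀ i, ¬ D i i) {x : α} {l : List α} :
    IsLinearExtension D S (x :: l) ↔
      IsTerminalIn D S x ∧ IsLinearExtension D (S.erase x) l := by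
  simp only [IsLinearExtension, IsTerminalIn, List.nodup_cons, List.toFinset_cons,
    List.pairwise_cons]
  constructor
  · rintro ⟨⟨hx, hl⟩, rfl, hxD, hlD⟩
    refine ⟨⟨Finset.mem_insert_self _ _, fun k hk => ?_⟩, hl, ?_, hlD⟩
    · rcases Finset.mem_insert.1 hk with rfl | hk
      · exact hD _
      · exact hxD k (List.mem_toFinset.1 hk)
    · rw [Finset.erase_insert (by simpa using hx)]
  · rintro ⟨⟨hxS, hxD⟩, hl, hlS, hlD⟩
    refine ⟨⟨fun h => ?_, hl⟩, by rw [hlS, Finset.insert_erase hxS], fun b hb => hxD b ?_, hlD⟩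
    · rw [← List.mem_toFinset, hlS] at h
      exact Finset.notMem_erase x S h
    · rw [← List.mem_toFinset, hlS] at hb
      exact Finset.mem_of_mem_erase hb

theorem nonempty_isLinearExtension_equiv_sigma (hD : ∀ i, ¬ D i i) (hS : S.Nonempty) :
    Nonempty ({l // IsLinearExtension D S l} ≃
      Σ x : {x // IsTerminalIn D S x}, {l // IsLinearExtension D (S.erase x) l}) := by
  refine ⟨(Equiv.ofBijective (fun s => ⟨s.1.1 :: s.2.1,
    (isLinearExtension_cons_iff hD).2 ⟨s.1.2, s.2.2⟩⟩) ⟨?_, ?_⟩).symm⟩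
  · rintro ⟨⟨x, hx⟩, l, hl⟩ ⟨⟨y, hy⟩, l', hl'⟩ h
    obtain ⟨h1, h2⟩ := List.cons.inj (congrArg Subtype.val h)
    exact Sigma.subtype_ext (Subtype.ext h1) h2
  · rintro ⟨l, hl⟩
    cases l with
    | nil => exact absurd hl.2.1.symm (by simpa using hS.ne_empty)
    | cons x l =>
      obtain ⟨h1, h2⟩ := (isLinearExtension_cons_iff hD).1 hl
      exact ⟨⟨⟨x, h1⟩, l, h2⟩, rfl⟩

/-- Linear extensions of `D` are equinumerous with the permutations whose cycles form an acyclic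
quotient of `D`. -/
theorem nonempty_isLinearExtension_equiv_isCycleAcyclic (hD : ∀ i, ¬ D i i) (S : Finset α) :
    Nonempty ({l // IsLinearExtension D S l} ≃ {τ // IsCycleAcyclic D S τ}) := by
  induction S using Finset.strongInduction with
  | H S ih =>
    rcases S.eq_empty_or_nonempty with rfl | hS
    · have u1 : Unique {l // IsLinearExtension D ∅ l} :=
        { default := ⟨[], by simp [IsLinearExtension]⟩
          uniq := fun l => Subtype.ext (List.toFinset_eq_empty_iff _ |>.1 l.2.2.1) }
      have u2 : Unique {τ // IsCycleAcyclic D (∅ : Finset α) τ} :=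
        { default := ⟨1, fun _ _ => rfl, fun _ => 0, fun _ => rfl, by simp⟩
          uniq := fun τ => Subtype.ext (Equiv.ext fun i => τ.2.1 i (Finset.notMem_empty i)) }
      exact ⟨Equiv.ofUnique _ _⟩
    · obtain ⟨e1⟩ := nonempty_isLinearExtension_equiv_sigma hD hS
      obtain ⟨e2⟩ := nonempty_isCycleAcyclic_equiv_sigma (D := D) hS
      exact ⟨e1.trans ((Equiv.sigmaCongrRight fun x =>
        (ih _ (Finset.erase_ssubset x.2.1)).some).trans e2.symm)⟩

end terminalCycles

theorem nonempty_perm_equiv_isLinearExtension {n : ℕ} (D : Fin n → Fin n → Prop)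
    (hD : ∀ i, ¬ D i i) :
    Nonempty ({σ : Perm (Fin n) // ∀ i j, D i j → σ.symm j < σ.symm i} ≃
      {l // IsLinearExtension D Finset.univ l}) := by
  refine ⟨Equiv.ofBijective (fun σ => ⟨List.ofFn σ.1, List.nodup_ofFn.2 σ.1.injective, ?_, ?_⟩)
    ⟨?_, ?_⟩⟩
  · ext i
    simpa using ⟨σ.1.symm i, by simp⟩
  · rw [List.pairwise_ofFn]
    intro i j hij h
    have := σ.2 _ _ h
    simp only [symm_apply_apply] at this
    exact lt_asymm hij this
  · rintro ⟨σ, hσ⟩ ⟨σ', hσ'⟩ h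
    exact Subtype.ext (Equiv.ext (congrFun (List.ofFn_injective (congrArg Subtype.val h))))
  · rintro ⟨l, hl, hlu, hlD⟩
    have hlen : l.length = n := by
      rw [← List.toFinset_card_of_nodup hl, hlu, Finset.card_univ, Fintype.card_fin]
    obtain ⟨f, rfl⟩ : ∃ f : Fin n → Fin n, l = List.ofFn f :=
      ⟨fun k => l.get (k.cast hlen.symm), List.ext_get (by simp [hlen]) (by simp)⟩
    rw [List.pairwise_ofFn] at hlD
    obtain ⟨σ, rfl⟩ : ∃ σ : Perm (Fin n), f = σ :=
      ⟨Equiv.ofBijective f (Finite.injective_iff_bijective.1 (List.nodup_ofFn.1 hl)), rfl⟩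
    refine ⟨⟨σ, fun i j hij => ?_⟩, rfl⟩
    by_contra hlt
    rcases (not_lt.1 hlt).lt_or_eq with h | h
    · exact hlD h (by simpa using hij)
    · rw [σ.symm.injective h] at hij
      exact hD _ hij

/-! ### Stability and hashing in terms of heights and envy -/

section allocation

variable {n : ℕ}

/-- A height function on the traders that is constant on the trading cycles of `g` and that drops
from each trader to the owners of the goods he prefers to his own allotment. -/
def HasTradingHeights (p : PrefProfile n) (g : Perm (Fin n)) : Prop :=
  ∃ ρ : Fin n → ℕ, (∀ k, ρ (g k) = ρ k) ∧
    ∀ k l, (p k).symm l < (p k).symm (g k) → ρ l < ρ k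

/-- A redistribution within `C` preserves the sum of heights over `C`, whereas each strict
improvement would lower it. -/
theorem HasTradingHeights.isStable {p : PrefProfile n} {g : Perm (Fin n)}
    (hg : HasTradingHeights p g) : IsStable p g := by
  obtain ⟨ρ, hρ, hlt⟩ := hg
  intro C _ h hC hw
  have hstep : ∀ k ∈ C, h k ≠ g k → ρ (h k) < ρ k := fun k hk hne =>
    hlt k _ (lt_of_le_of_ne (hw k hk) fun e => hne ((p k).symm.injective e))
  have hle : ∀ k ∈ C, ρ (h k) ≤ ρ k := fun k hk => by
    by_cases e : h k = g k
    · rw [e, hρ]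
    · exact (hstep k hk e).le
  have hsum : ∑ k ∈ C, ρ (h k) = ∑ k ∈ C, ρ k :=
    Finset.sum_bij (fun k _ => h k) (fun k hk => hC.mapsTo hk)
      (fun a ha b hb e => hC.injOn ha hb e) (fun b hb => by
        obtain ⟨a, ha, e⟩ := hC.surjOn hb
        exact ⟨a, ha, e⟩) fun _ _ => rfl
  intro k hk
  by_contra hne
  exact (Finset.sum_lt_sum hle ⟨k, hk, hstep k hk hne⟩).ne hsum

theorem HasTradingHeights.eq_of_isStable {p : PrefProfile n} {g g' : Perm (Fin n)}
    (hg : HasTradingHeights p g) (hg' : IsStable p g') : g' = g := by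
  obtain ⟨ρ, hρ, hlt⟩ := hg
  suffices H : ∀ t k, ρ k = t → g k = g' k from Equiv.ext fun k => (H _ k rfl).symm
  intro t
  induction t using Nat.strong_induction_on with
  | _ t ih =>
    intro k hk
    -- The level set `t` can trade by `g` on its own, so stability of `g'` applies if no member
    -- prefers `g'`. A preferred good would lie at a lower height, where `g` and `g'` agree by
    -- induction, so `g'` gives it to a lower trader.
    refine hg' (Finset.univ.filter fun i => ρ i = t) ⟨k, by simpa using hk⟩ g
      ⟨?_, g.injective.injOn, ?_⟩ ?_ k (by simpa using hk)
    · intro i hi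
      simpa [hρ] using hi
    · intro i hi
      refine ⟨g.symm i, ?_, g.apply_symm_apply i⟩
      have := hρ (g.symm i)
      rw [g.apply_symm_apply] at this
      simpa [← this] using hi
    · intro i hi
      have hi : ρ i = t := by simpa using hi
      by_contra hw
      have h1 : ρ (g' i) < t := hi ▸ hlt i _ (not_le.1 hw)
      have h2 := hρ (g.symm (g' i))
      rw [g.apply_symm_apply] at h2
      have h3 := ih _ h1 (g.symm (g' i)) h2.symm
      rw [g.apply_symm_apply] at h3
      have h4 : g.symm (g' i) = i := (g'.injective h3).symm
      rw [h4, hi] at h2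
      omega

/-- `Envies p a i j`: agent `i` prefers the good of agent `j` under `a` to his own. -/
def Envies (p : PrefProfile n) (a : Perm (Fin n)) (i j : Fin n) : Prop :=
  (p i).symm (a j) < (p i).symm (a i)

/-- Passing from traders to lists by `σ` conjugates `a * σ` into `σ * a`, and heights are
transported along `σ`. -/
theorem hasTradingHeights_iff_isCycleAcyclic (p : PrefProfile n) (a σ : Perm (Fin n)) :
    HasTradingHeights (fun k => p (σ k)) (a * σ) ↔
      IsCycleAcyclic (Envies p a) Finset.univ (σ * a) := by
  constructor
  · rintro ⟨ρ, hρ, hlt⟩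
    have hρ' : ∀ i, ρ (a i) = ρ (σ.symm i) := fun i => by simpa using hρ (σ.symm i)
    refine ⟨by simp, fun i => ρ (σ.symm i), fun i => by simp [hρ'], fun i _ j _ hij => ?_⟩
    rw [show (fun i => ρ (σ.symm i)) j = ρ (a j) from (hρ' j).symm]
    exact hlt (σ.symm i) (a j) (by simpa [Envies] using hij)
  · rintro ⟨-, ρ, hρ, hlt⟩
    refine ⟨fun k => ρ (σ k), fun k => by simpa using hρ (σ k), fun k l hl => ?_⟩
    have := hρ (a.symm l)
    simp only [Perm.mul_apply, apply_symm_apply] at this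
    simp only [this]
    exact hlt _ (Finset.mem_univ _) _ (Finset.mem_univ _) (by simpa [Envies] using hl)

theorem hashProduces_iff_comp (p : PrefProfile n) (π : Perm (Fin n)) (r : Fin n → Fin n) :
    HashProduces p π r ↔ HashProduces (fun k => p (π k)) 1 (fun k => r (π k)) := Iff.rfl

theorem HashProduces.injective {p : PrefProfile n} {r : Fin n → Fin n}
    (h : HashProduces p 1 r) : Function.Injective fun k => p k (r k) := by
  intro i j hij
  by_contra hne
  rcases lt_or_gt_of_ne hne with hlt | hlt
  · exact (h j).1 i hlt hij.symm
  · exact (h i).1 j hlt hij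

theorem HashProduces.unique {p : PrefProfile n} {π : Perm (Fin n)} {r r' : Fin n → Fin n}
    (h : HashProduces p π r) (h' : HashProduces p π r') : r = r' := by
  suffices H : ∀ k, r (π k) = r' (π k) from funext fun k => by simpa using H (π.symm k)
  intro k
  induction k using WellFoundedLT.induction with
  | _ k ih =>
    have e : {j : Fin n | ∀ i < k, p (π k) j ≠ p (π i) (r (π i))} =
        {j : Fin n | ∀ i < k, p (π k) j ≠ p (π i) (r' (π i))} := by
      ext j
      exact forall₂_congr fun i hi => by rw [ih i hi]
    exact (e ▸ h k).unique (h' k)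

theorem exists_hashProduces (p : PrefProfile n) (π : Perm (Fin n)) :
    ∃ r, HashProduces p π r := by
  suffices H : ∀ q : PrefProfile n, ∃ r, HashProduces q 1 r by
    obtain ⟨r, hr⟩ := H fun k => p (π k)
    exact ⟨fun k => r (π.symm k), by simpa [hashProduces_iff_comp p π] using hr⟩
  intro q
  suffices H : ∀ m : ℕ, ∃ r : Fin n → Fin n, ∀ k : Fin n, (k : ℕ) < m →
      IsLeast {j : Fin n | ∀ i < k, q k j ≠ q i (r i)} (r k) by
    obtain ⟨r, hr⟩ := H n
    exact ⟨r, fun k => hr k k.2⟩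
  intro m
  induction m with
  | zero => exact ⟨id, fun k hk => absurd hk (Nat.not_lt_zero _)⟩
  | succ m ih =>
    obtain ⟨r, hr⟩ := ih
    by_cases hm : m < n
    swap
    · exact ⟨r, fun k _ => hr k (by omega)⟩
    obtain ⟨c, hc⟩ : ∃ c : Fin n, (c : ℕ) = m := ⟨⟨m, hm⟩, rfl⟩
    have hne : {j : Fin n | ∀ i < c, q c j ≠ q i (r i)}.Nonempty := by
      by_contra hempty
      have hall : ∀ j, ∃ i < c, q c j = q i (r i) := by
        intro j
        by_contra hj
        push Not at hj
        exact hempty ⟨j, hj⟩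
      choose f hf hfe using hall
      -- If every position were blocked, `f` would inject all positions into the traders before `c`;
      -- by finiteness it would also hit `c`.
      have hinj : Function.Injective f := fun x y e =>
        (q c).injective (by rw [hfe x, hfe y, e])
      obtain ⟨j, hj⟩ := Finite.surjective_of_injective hinj c
      exact (hf j).ne hj
    obtain ⟨x, hxS, hx⟩ := Set.exists_min_image _ id (Set.toFinite _) hne
    refine ⟨Function.update r c x, fun k hk => ?_⟩
    have hset : {j : Fin n | ∀ i < k, q k j ≠ q i (Function.update r c x i)} =
        {j : Fin n | ∀ i < k, q k j ≠ q i (r i)} := by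
      ext j
      refine forall₂_congr fun i hi => ?_
      rw [Function.update_of_ne]
      rintro rfl
      omega
    rw [hset]
    by_cases hkc : k = c
    · subst hkc
      rw [Function.update_self]
      exact ⟨hxS, hx⟩
    · rw [Function.update_of_ne hkc]
      exact hr k (by have := Fin.val_ne_of_ne hkc; omega)

/-- Since `a` is onto, each good that `i` prefers to his own has an owner under `a`; it is
unavailable to `i` exactly if that owner came earlier. -/
theorem hashProduces_iff_envies (p : PrefProfile n) (a σ : Perm (Fin n)) :
    HashProduces p σ (fun i => (p i).symm (a i)) ↔
      ∀ i j, Envies p a i j → σ.symm j < σ.symm i := by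
  constructor
  · intro h i j hij
    by_contra hlt
    refine not_le.2 hij ?_
    have := mem_lowerBounds.1 (h (σ.symm i)).2 ((p i).symm (a j)) fun l hl => ?_
    · simpa using this
    · simp only [apply_symm_apply, ne_eq, a.injective.eq_iff]
      rintro rfl
      exact hlt (by simpa using hl)
  · intro h k
    refine ⟨fun l hl => ?_, fun j hj => ?_⟩
    · simp [hl.ne']
    · by_contra hlt
      have := h (σ k) (a.symm (p (σ k) j)) (by simpa [Envies] using hlt)
      rw [symm_apply_apply] at this
      exact hj _ this (by simp)

theorem nonempty_hash_equiv_heights (p : PrefProfile n) (a : Perm (Fin n)) :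
    Nonempty ({σ : Perm (Fin n) // HashProduces p σ fun i => (p i).symm (a i)} ≃
      {σ : Perm (Fin n) // HasTradingHeights (fun k => p (σ k)) (a * σ)}) := by
  have hD : ∀ i, ¬ Envies p a i i := fun i => lt_irrefl _
  obtain ⟨e1⟩ := nonempty_perm_equiv_isLinearExtension (Envies p a) hD
  obtain ⟨e2⟩ := nonempty_isLinearExtension_equiv_isCycleAcyclic hD Finset.univ
  exact ⟨(Equiv.subtypeEquivRight fun σ => hashProduces_iff_envies p a σ).trans
    (e1.trans (e2.trans (Equiv.subtypeEquiv (Equiv.mulRight a) fun σ =>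
      hasTradingHeights_iff_isCycleAcyclic p a σ).symm))⟩

end allocation

/-- If `Q a σ` determines `a`, then the `σ` for which some admissible `a` satisfies `Q a σ` are
the disjoint union of the fibres of `Q`. -/
noncomputable def sigmaEquivExistsOfUnique {α β : Type*} (M : α → Prop) (Q : α → β → Prop)
    (hQ : ∀ a a' σ, Q a σ → Q a' σ → a = a') :
    (Σ a : {a // M a}, {σ // Q a σ}) ≃ {σ // ∃ a, M a ∧ Q a σ} :=
  Equiv.ofBijective (fun s => ⟨s.2.1, s.1.1, s.1.2, s.2.2⟩) ⟨by
    rintro ⟨⟨a, ha⟩, σ, hσ⟩ ⟨⟨a', ha'⟩, σ', hσ'⟩ h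
    have h : σ = σ' := congrArg Subtype.val h
    subst h
    exact Sigma.subtype_ext (Subtype.ext (hQ _ _ _ hσ hσ')) rfl, by
    rintro ⟨σ, a, ha, hσ⟩
    exact ⟨⟨⟨a, ha⟩, σ, hσ⟩, rfl⟩⟩

/-! ### Counting over the rearrangements of one profile -/

section averaging

variable {n : ℕ}

/-- The positions of the goods of the allocation `a` in the lists of their recipients. -/
def allocationPositions (p : PrefProfile n) (a : Perm (Fin n)) (i : Fin n) : Fin n :=
  (p i).symm (a i)

theorem allocationPositions_injective (p : PrefProfile n) :
    Function.Injective (allocationPositions p) := fun _ _ h =>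
  Equiv.ext fun i => (p i).symm.injective (congrFun h i)

theorem HashProduces.exists_allocationPositions {p : PrefProfile n} {σ : Perm (Fin n)}
    {r : Fin n → Fin n} (h : HashProduces p σ r) : ∃ a, r = allocationPositions p a := by
  have hinj : Function.Injective fun i => p i (r i) := by
    have := (((hashProduces_iff_comp p σ r).1 h).injective).comp σ.symm.injective
    simpa [Function.comp_def] using this
  exact ⟨Equiv.ofBijective _ (Finite.injective_iff_bijective.1 hinj), funext fun i => by
    simp [allocationPositions]⟩

theorem hashHasRanks_iff (p : PrefProfile n) (σ : Perm (Fin n)) (R : Multiset ℕ) :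
    HashHasRanks p σ R ↔ ∃ a, rankMultiset (allocationPositions p a) = R ∧
      HashProduces p σ (allocationPositions p a) := by
  constructor
  · rintro ⟨r, hr, hR⟩
    obtain ⟨a, rfl⟩ := hr.exists_allocationPositions
    exact ⟨a, hR, hr⟩
  · rintro ⟨a, hR, hr⟩
    exact ⟨_, hr, hR⟩

/-- The predicate `M` is left free: the trivial choice gives existence of stable allocations, and
fixing the rank multiset gives the count. -/
theorem nonempty_exists_hash_equiv_exists_heights (p : PrefProfile n)
    (M : Perm (Fin n) → Prop) :
    Nonempty ({σ : Perm (Fin n) // ∃ a, M a ∧ HashProduces p σ (allocationPositions p a)} ≃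
      {σ : Perm (Fin n) // ∃ a, M a ∧ HasTradingHeights (fun k => p (σ k)) (a * σ)}) :=
  ⟨(sigmaEquivExistsOfUnique M (fun a σ => HashProduces p σ (allocationPositions p a))
      fun _ _ _ h h' => allocationPositions_injective p (h.unique h')).symm.trans
    ((Equiv.sigmaCongrRight fun a : {a // M a} => (nonempty_hash_equiv_heights p a.1).some).trans
      (sigmaEquivExistsOfUnique M
        (fun a (σ : Perm (Fin n)) => HasTradingHeights (fun k => p (σ k)) (a * σ))
        fun _ _ _ h h' => mul_right_cancel (h'.eq_of_isStable h.isStable)))⟩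

/-- Hashing succeeds for every `σ`, so by the bijection and finiteness every rearrangement has an
allocation with heights, in particular the identity one. -/
theorem exists_hasTradingHeights (p : PrefProfile n) : ∃ g, HasTradingHeights p g := by
  obtain ⟨e⟩ := nonempty_exists_hash_equiv_exists_heights p fun _ => True
  have hall : ∀ σ : Perm (Fin n), ∃ a, True ∧ HashProduces p σ (allocationPositions p a) := by
    intro σ
    obtain ⟨r, hr⟩ := exists_hashProduces p σ
    obtain ⟨a, rfl⟩ := hr.exists_allocationPositions
    exact ⟨a, trivial, hr⟩
  have hinj : Function.Injective fun σ : Perm (Fin n) => (e ⟨σ, hall σ⟩).1 := fun σ σ' h =>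
    congrArg Subtype.val (e.injective (Subtype.ext h))
  obtain ⟨σ, hσ⟩ := Finite.surjective_of_injective hinj 1
  obtain ⟨a, -, ha⟩ := (e ⟨σ, hall σ⟩).2
  simp only at hσ
  rw [hσ] at ha
  exact ⟨a, by simpa using ha⟩

theorem isStable_iff_hasTradingHeights {p : PrefProfile n} {g : Perm (Fin n)} :
    IsStable p g ↔ HasTradingHeights p g := by
  refine ⟨fun h => ?_, HasTradingHeights.isStable⟩
  obtain ⟨g', hg'⟩ := exists_hasTradingHeights p
  rwa [hg'.eq_of_isStable h]

theorem rankMultiset_comp_perm (r : Fin n → Fin n) (σ : Perm (Fin n)) :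
    rankMultiset (fun k => r (σ k)) = rankMultiset r := by
  unfold rankMultiset
  conv_rhs => rw [← Finset.map_univ_equiv σ, Finset.map_val, Multiset.map_map]
  rfl

theorem stableHasRanks_comp_iff (p : PrefProfile n) (σ : Perm (Fin n)) (R : Multiset ℕ) :
    StableHasRanks (fun k => p (σ k)) R ↔ ∃ a, rankMultiset (allocationPositions p a) = R ∧
      HasTradingHeights (fun k => p (σ k)) (a * σ) := by
  simp only [StableHasRanks, isStable_iff_hasTradingHeights]
  constructor
  · rintro ⟨g, hg, hR⟩
    refine ⟨g * σ⁻¹, ?_, by simpa using hg⟩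
    rw [← hR, ← rankMultiset_comp_perm _ σ]
    simp [allocationPositions]
  · rintro ⟨a, hR, ha⟩
    refine ⟨a * σ, ha, ?_⟩
    rw [← hR]
    exact rankMultiset_comp_perm (allocationPositions p a) σ

/-- Only the order in which the lists are served matters, so rearranging them is a change of
priorities; this makes the choice of `π` immaterial in the count. -/
theorem hashHasRanks_comp_iff (p : PrefProfile n) (σ π : Perm (Fin n)) (R : Multiset ℕ) :
    HashHasRanks (fun k => p (σ k)) π R ↔ HashHasRanks p (σ * π) R := by
  constructor
  · rintro ⟨r, hr, hR⟩
    refine ⟨fun i => r (σ.symm i), ?_, by rw [← hR]; exact rankMultiset_comp_perm r σ.symm⟩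
    rw [hashProduces_iff_comp] at hr ⊢
    simpa using hr
  · rintro ⟨r, hr, hR⟩
    exact ⟨fun k => r (σ k), hr, by rw [rankMultiset_comp_perm, hR]⟩

/-- Among the rearrangements of a profile, as many have the stable rank multiset `R` as have
the hashing rank multiset `R`. -/
theorem card_stableHasRanks_comp (p : PrefProfile n) (π : Perm (Fin n)) (R : Multiset ℕ) :
    Nat.card {σ : Perm (Fin n) // StableHasRanks (fun k => p (σ k)) R} =
      Nat.card {σ : Perm (Fin n) // HashHasRanks (fun k => p (σ k)) π R} := by
  obtain ⟨e⟩ := nonempty_exists_hash_equiv_exists_heights p fun a =>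
    rankMultiset (allocationPositions p a) = R
  exact Nat.card_congr ((Equiv.subtypeEquivRight fun σ => stableHasRanks_comp_iff p σ R).trans
    (e.symm.trans (Equiv.subtypeEquiv (Equiv.mulRight π) fun σ =>
      (hashHasRanks_comp_iff p σ π R).trans (hashHasRanks_iff p _ R)).symm))

end averaging

/-! ### From counts to probabilities -/

section exchangeable

open MeasureTheory ProbabilityTheory

instance discreteMeasurableSpacePrefList (n : ℕ) : DiscreteMeasurableSpace (PrefList n) :=
  ⟨fun _ => trivial⟩

/-- An exchangeable law on `ι → E` with `ι` and `E` finite gives equal mass to two sets that every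
orbit meets equally often. -/
theorem measure_eq_of_card_comp_eq {ι E : Type*} [Fintype ι] [DecidableEq ι] [Finite E]
    [MeasurableSpace (ι → E)] [DiscreteMeasurableSpace (ι → E)] (ν : Measure (ι → E))
    (hν : ∀ σ : Perm ι, ν.map (fun p k => p (σ k)) = ν) (S T : (ι → E) → Prop)
    (hST : ∀ p : ι → E, Nat.card {σ : Perm ι // S fun k => p (σ k)} =
      Nat.card {σ : Perm ι // T fun k => p (σ k)}) :
    ν {p | S p} = ν {p | T p} := by
  classical
  have := Fintype.ofFinite (ι → E)
  -- Double counting: average the event over all `σ`, then exchange the sums over `σ` and `p`.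
  have key : ∀ S : (ι → E) → Prop, (Nat.card (Perm ι) : ENNReal) * ν {p | S p} =
      ∑ p, (Nat.card {σ : Perm ι // S fun k => p (σ k)} : ENNReal) * ν {p} := by
    intro S
    have h1 : ∀ σ : Perm ι, ν {p | S p} =
        ∑ p, if S (fun k => p (σ k)) then ν {p} else 0 := by
      intro σ
      conv_lhs => rw [← hν σ, Measure.map_apply .of_discrete .of_discrete]
      rw [← Finset.sum_filter, sum_measure_singleton]
      congr 1
      ext p
      simp
    calc (Nat.card (Perm ι) : ENNReal) * ν {p | S p}
        = ∑ σ : Perm ι, ∑ p, if S (fun k => p (σ k)) then ν {p} else 0 := by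
          simp only [← h1, Finset.sum_const, Finset.card_univ, Nat.card_eq_fintype_card,
            nsmul_eq_mul]
      _ = _ := by
          rw [Finset.sum_comm]
          refine Finset.sum_congr rfl fun p _ => ?_
          rw [← Finset.sum_filter, Finset.sum_const, nsmul_eq_mul, Nat.card_eq_fintype_card,
            Fintype.card_subtype]
  have h : (Nat.card (Perm ι) : ENNReal) * ν {p | S p} =
      (Nat.card (Perm ι) : ENNReal) * ν {p | T p} := by
    rw [key S, key T]
    exact Finset.sum_congr rfl fun p _ => by rw [hST]
  exact (ENNReal.mul_right_inj (by simp) (ENNReal.natCast_ne_top _)).1 h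

theorem measure_stableHasRanks_eq {n : ℕ} {Ω : Type*} [MeasurableSpace Ω] (μ : Measure Ω)
    (P : Fin n → Ω → PrefList n) (hP : ∀ k, Measurable (P k))
    (hσ : ∀ σ : Perm (Fin n), IdentDistrib (fun ω k => P (σ k) ω) (fun ω k => P k ω) μ μ)
    (π : Perm (Fin n)) (R : Multiset ℕ) :
    μ {ω | StableHasRanks (fun k => P k ω) R} = μ {ω | HashHasRanks (fun k => P k ω) π R} := by
  have hm : Measurable fun ω k => P k ω := measurable_pi_lambda _ hP
  have h := measure_eq_of_card_comp_eq (μ.map fun ω k => P k ω)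
    (fun σ => by
      rw [Measure.map_map .of_discrete hm]
      exact (hσ σ).map_eq)
    (fun p => StableHasRanks p R) (fun p => HashHasRanks p π R)
    fun p => card_stableHasRanks_comp p π R
  rwa [Measure.map_apply hm .of_discrete, Measure.map_apply hm .of_discrete] at h

theorem identDistrib_comp_perm_of_iIndepFun {ι E Ω : Type*} [Fintype ι] [MeasurableSpace E]
    [MeasurableSpace Ω] {μ : Measure Ω} [IsProbabilityMeasure μ] {P : ι → Ω → E}
    (hP : ∀ k, Measurable (P k)) (hindep : iIndepFun P μ)
    (hlaw : ∀ i j, μ.map (P i) = μ.map (P j)) (σ : Perm ι) :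
    IdentDistrib (fun ω k => P (σ k) ω) (fun ω k => P k ω) μ μ where
  aemeasurable_fst := (measurable_pi_lambda _ fun k => hP (σ k)).aemeasurable
  aemeasurable_snd := (measurable_pi_lambda _ hP).aemeasurable
  map_eq := by
    rw [(iIndepFun_iff_map_fun_eq_pi_map fun k => (hP k).aemeasurable).1 hindep,
      (iIndepFun_iff_map_fun_eq_pi_map fun k => (hP (σ k)).aemeasurable).1
        (hindep.precomp σ.injective)]
    congr 1
    exact funext fun k => hlaw _ _

end exchangeable

theorem mainTheorem1 (n : ℕ) :
    -- the stable allocation exists and is unique, and uniform hashing is well defined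
    (∀ p : PrefProfile n, ∃! g : Equiv.Perm (Fin n), IsStable p g) ∧
    (∀ (p : PrefProfile n) (π : Equiv.Perm (Fin n)), ∃! r : Fin n → Fin n, HashProduces p π r) ∧
    ∀ {Ω : Type*} [MeasurableSpace Ω] (μ : MeasureTheory.Measure Ω)
      [MeasureTheory.IsProbabilityMeasure μ] (P : Fin n → Ω → PrefList n),
      (∀ k, Measurable (P k)) →
      -- independent and uniformly random preference lists
      ((ProbabilityTheory.iIndepFun P μ ∧
          (∀ (k : Fin n) (q : PrefList n), μ {ω | P k ω = q} = ((n.factorial : ENNReal))⁻¹) →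
        ∀ (π : Equiv.Perm (Fin n)) (R : Multiset ℕ),
          μ {ω | StableHasRanks (fun k => P k ω) R} =
            μ {ω | HashHasRanks (fun k => P k ω) π R}) ∧
      -- more generally, a joint distribution that is invariant under shuffling the lists
      ((∀ σ : Equiv.Perm (Fin n),
          ProbabilityTheory.IdentDistrib (fun ω k => P (σ k) ω) (fun ω k => P k ω) μ μ) →
        ∀ (π : Equiv.Perm (Fin n)) (R : Multiset ℕ),
          μ {ω | StableHasRanks (fun k => P k ω) R} =
            μ {ω | HashHasRanks (fun k => P k ω) π R})) := by
  refine ⟨fun p => ?_, fun p π => ?_, fun μ _ P hP => ⟨fun h π R => ?_, fun h π R => ?_⟩⟩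
  · obtain ⟨g, hg⟩ := exists_hasTradingHeights p
    exact ⟨g, hg.isStable, fun g' hg' => hg.eq_of_isStable hg'⟩
  · obtain ⟨r, hr⟩ := exists_hashProduces p π
    exact ⟨r, hr, fun r' hr' => hr'.unique hr⟩
  · refine measure_stableHasRanks_eq μ P hP
      (identDistrib_comp_perm_of_iIndepFun hP h.1 fun i j => ?_) π R
    refine MeasureTheory.Measure.ext_of_singleton fun q => ?_
    rw [MeasureTheory.Measure.map_apply (hP i) .of_discrete,
      MeasureTheory.Measure.map_apply (hP j) .of_discrete]
    exact (h.2 i q).trans (h.2 j q).symm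
  · exact measure_stableHasRanks_eq μ P hP h π R
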